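/- Let $n\ge 0$, let $f\in C^2(\mathbb{R}^n)$ be real-valued, and let $g:\mathbb{R}^n\to\mathbb{R}\cup\{\infty\}$ be a proper polyhedral function (its epigraph is the intersection of finitely many closed half-spaces of $\mathbb{R}^n\times\mathbb{R}$) with $\mathrm{dom}\,g=\{x: g(x)<\infty\}\subseteq\mathbb{R}^n_+$. For $y\in\mathbb{R}^n$ let $y^2$ denote the componentwise square, and put $\phi(x)=f(x)+g(x)$ and $\Phi(y)=f(y^2)+g(y^2)$. For $h:\mathbb{R}^n\to\mathbb{R}\cup\{\infty\}$ and a point $x$ with $h(x)$ finite, a vector $v$ is a regular subgradient of $h$ at $x$, written $v\in\hat\partial h(x)$, if $h(z)\ge h(x)+\langle v,z-x\rangle+o(\|z-x\|)$ as $z\to x$; and $v\in\partial h(x)$ if there are $x^k\to x$ with $h(x^k)\to h(x)$ and $v^k\in\hat\partial h(x^k)$ with $v^k\to v$. If $h(x)=\infty$, then $\hat\partial h(x)=\partial h(x)=\emptyset$. The point $x$ is a stationary point of $h$ if $0\in\partial h(x)$. For $h(x)$ finite and $v,w\in\mathbb{R}^n$, the second subderivative is $$d^2h(x|v)(w)=\liminf_{t\downarrow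 0,\ w'\to w}\frac{h(x+tw')-h(x)-t\langle v,w'\rangle}{\tfrac12 t^2}.$$ For every $y\in\mathbb{R}^n$, with $I=\{i: y_i\ne 0\}$ and $S_I=\{w\in\mathbb{R}^n: w_i=0\text{ for all }i\in I\}$, the following are equivalent: (i) $y$ is a stationary point of $\Phi$, and $d^2\Phi(y|0)(w)\ge 0$ for all $w\in S_I$; (ii) $x=y^2$ is a stationary point of $\phi$. -/

import Mathlib

open Filter Topology

namespace SquareReparam

/-- `ℝⁿ` with its Euclidean structure. -/
abbrev Rn (n : ℕ) : Type := EuclideanSpace ℝ (Fin n)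

/-- The componentwise square `y ↦ y²`. -/
noncomputable def sq {n : ℕ} (y : Rn n) : Rn n :=
  WithLp.toLp 2 (fun i => y i ^ 2)

/-- The effective domain of an extended real-valued function. -/
def dom {n : ℕ} (h : Rn n → EReal) : Set (Rn n) := {x | h x < ⊤}

/-- The nonnegative orthant of `ℝⁿ`. -/
def nonnegOrthant (n : ℕ) : Set (Rn n) := {x | ∀ i, 0 ≤ x i}

/-- Proper: finite somewhere, and nowhere `-∞`. -/
def IsProper {n : ℕ} (h : Rn n → EReal) : Prop :=
  (dom h).Nonempty ∧ ∀ x, h x ≠ ⊥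

/-- The epigraph, a subset of `ℝⁿ × ℝ`. -/
def epigraph {n : ℕ} (h : Rn n → EReal) : Set (Rn n × ℝ) :=
  {p | h p.1 ≤ (p.2 : EReal)}

/-- A (convex) polyhedral function: its epigraph is a polyhedral set, i.e. the intersection of
finitely many closed half-spaces `⟨a j, x⟩ + b j * r ≤ c j` of `ℝⁿ × ℝ`. -/
def IsPolyhedralFun {n : ℕ} (h : Rn n → EReal) : Prop :=
  ∃ (m : ℕ) (a : Fin m → Rn n) (b c : Fin m → ℝ),
    epigraph h = {p | ∀ j, inner ℝ (a j) p.1 + b j * p.2 ≤ c j}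

/-- The regular subdifferential: `h` is finite at `x` and
`h z ≥ h x + ⟨v, z - x⟩ + o(‖z - x‖)` as `z → x`. It is empty where `h` is infinite. -/
def regularSubdiff {n : ℕ} (h : Rn n → EReal) (x : Rn n) : Set (Rn n) :=
  {v | h x ≠ ⊤ ∧ h x ≠ ⊥ ∧ ∀ ε : ℝ, 0 < ε → ∀ᶠ z in 𝓝 x,
    h x + ((inner ℝ v (z - x) - ε * ‖z - x‖ : ℝ) : EReal) ≤ h z}

/-- The (limiting) subdifferential: `h` is finite at `x`, and `v` is a limit of regular
subgradients `v k` of `h` at points `x k` with `x k → x` and `h (x k) → h x`. -/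
def subdiff {n : ℕ} (h : Rn n → EReal) (x : Rn n) : Set (Rn n) :=
  {v | h x ≠ ⊤ ∧ h x ≠ ⊥ ∧ ∃ (xs vs : ℕ → Rn n),
    Tendsto xs atTop (𝓝 x) ∧ Tendsto (fun k => h (xs k)) atTop (𝓝 (h x)) ∧
    Tendsto vs atTop (𝓝 v) ∧ ∀ k, vs k ∈ regularSubdiff h (xs k)}

/-- `x` is a stationary point of `h` if `0 ∈ ∂h(x)`. -/
def IsStationary {n : ℕ} (h : Rn n → EReal) (x : Rn n) : Prop :=
  (0 : Rn n) ∈ subdiff h x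

/-- The second subderivative `d²h(x|v)(w)` (at a point `x` where `h` is finite): the lower limit of
`(h (x + t w') - h x - t ⟨v, w'⟩) / (t² / 2)` as `t ↓ 0` and `w' → w`. -/
noncomputable def secondSubderiv {n : ℕ} (h : Rn n → EReal) (x v w : Rn n) : EReal :=
  liminf (fun q : ℝ × Rn n =>
      (h (x + q.1 • q.2) - h x - ((q.1 * inner ℝ v q.2 : ℝ) : EReal)) /
        ((q.1 ^ 2 / 2 : ℝ) : EReal))
    (𝓝[>] (0 : ℝ) ×ˢ 𝓝 w)

/-- The objective `φ = f + g`. -/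
noncomputable def phi {n : ℕ} (f : Rn n → ℝ) (g : Rn n → EReal) (x : Rn n) : EReal :=
  (f x : EReal) + g x

/-- The reparameterized objective `Φ(y) = f(y²) + g(y²)`. -/
noncomputable def Phi {n : ℕ} (f : Rn n → ℝ) (g : Rn n → EReal) (y : Rn n) : EReal :=
  (f (sq y) : EReal) + g (sq y)

/-- The index set `supp y` of the nonzero components of `y`. -/
def supp {n : ℕ} (y : Rn n) : Set (Fin n) := {i | y i ≠ 0}

/-- The linear subspace `S_I` of the vectors whose components with index in `I` vanish. -/
def vanishingOn {n : ℕ} (I : Set (Fin n)) : Set (Rn n) := {w | ∀ i ∈ I, w i = 0}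

end SquareReparam

/-! ### Stationarity of φ and the first-order condition -/

namespace SquareReparam

/-! Both (i) and (ii) amount to `FirstOrder` at x = y². For (ii) this is convexity of g together
with continuity of f and its derivative. From `FirstOrder`, Taylor's formula gives Φ(u) ≥ Φ(y) -
C‖u² - y²‖² near y. Since u² - y² = O(‖u - y‖), y is stationary; along y + tw' with w' → w ∈ S_I
even u² - y² = o(t), so the second subderivative is nonnegative. From (i), each segment from y² to z
∈ dom g lifts to a curve with (y + t w_t)² = y² + t²(z - y²) and w_t → w_0 ∈ S_I
(`sq_add_smul_sqrtVelocity`). Second order in t for Φ is thus first order for φ; stationarity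
supplies finiteness of Φ(y). -/

/-- The first-order condition `-∇f(x) ∈ ∂g(x)`, with the convex subgradient inequality. -/
def FirstOrder {n : ℕ} (f : Rn n → ℝ) (g : Rn n → EReal) (x : Rn n) : Prop :=
  ∃ r : ℝ, g x = r ∧ ∀ z (s : ℝ), g z = s → r - fderiv ℝ f x (z - x) ≤ s

/-- Polyhedrality enters the proof only through this convexity inequality. -/
theorem IsPolyhedralFun.le_segment {n : ℕ} {g : Rn n → EReal} (hg : IsPolyhedralFun g)
    {x z : Rn n} {r s t : ℝ} (hx : g x = r) (hz : g z = s) (h0 : 0 ≤ t) (h1 : t ≤ 1) :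
    g (x + t • (z - x)) ≤ ((r + t * (s - r) : ℝ) : EReal) := by
  obtain ⟨m, a, b, c, h⟩ := hg
  have mem : ∀ p : Rn n × ℝ, g p.1 ≤ (p.2 : EReal) ↔ ∀ j, inner ℝ (a j) p.1 + b j * p.2 ≤ c j :=
    fun p => Set.ext_iff.1 h p
  have h2 := (mem (x, r)).1 hx.le
  have h3 := (mem (z, s)).1 hz.le
  refine (mem (x + t • (z - x), r + t * (s - r))).2 fun j => ?_
  have h4 := mul_le_mul_of_nonneg_left (h2 j) (sub_nonneg.2 h1)
  have h5 := mul_le_mul_of_nonneg_left (h3 j) h0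
  simp only [inner_add_right, inner_smul_right, inner_sub_right] at *
  linarith

/-- The difference quotient along a ray converges to the directional derivative. -/
theorem tendsto_ray {n : ℕ} {f : Rn n → ℝ} (hf : Differentiable ℝ f) (x d : Rn n) :
    Tendsto (fun t : ℝ => (f (x + t • d) - f x) / t) (𝓝[>] 0) (𝓝 (fderiv ℝ f x d)) := by
  have h : HasLineDerivAt ℝ f (fderiv ℝ f x d) x d := (hf x).hasFDerivAt.hasLineDerivAt d
  refine h.tendsto_slope_zero_right.congr fun t => ?_
  rw [smul_eq_mul, div_eq_inv_mul]

theorem phi_eq_coe {n : ℕ} {f : Rn n → ℝ} {g : Rn n → EReal} {x : Rn n} {r : ℝ}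
    (h : g x = r) : phi f g x = ((f x + r : ℝ) : EReal) := by
  rw [phi, h, EReal.coe_add]

theorem exists_coe_of_phi {n : ℕ} {f : Rn n → ℝ} {g : Rn n → EReal} (hg : ∀ x, g x ≠ ⊥)
    {x : Rn n} (h : phi f g x ≠ ⊤) : ∃ r : ℝ, g x = r := by
  have : g x ≠ ⊤ := by
    intro h'
    apply h
    rw [phi, h', EReal.coe_add_top]
  exact ⟨(g x).toReal, (EReal.coe_toReal this (hg x)).symm⟩

theorem exists_coe_or_eq_top {n : ℕ} {g : Rn n → EReal} (hg : ∀ x, g x ≠ ⊥) (x : Rn n) :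
    (∃ r : ℝ, g x = r) ∨ g x = ⊤ := by
  by_cases h : g x = ⊤
  · exact Or.inr h
  · exact Or.inl ⟨(g x).toReal, (EReal.coe_toReal h (hg x)).symm⟩

/-- Convexity makes the local inequality global: restrict it to the segment towards z, divide by t,
let t ↓ 0 and then ε ↓ 0. -/
theorem inner_le_of_mem_regularSubdiff {n : ℕ} {f : Rn n → ℝ} (hf : Differentiable ℝ f)
    {g : Rn n → EReal} (hg : IsPolyhedralFun g)
    {x z v : Rn n} {r s : ℝ} (hx : g x = r) (hz : g z = s)
    (hv : v ∈ regularSubdiff (phi f g) x) :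
    inner ℝ v (z - x) ≤ fderiv ℝ f x (z - x) + (s - r) := by
  set d := z - x with hd
  have key : ∀ ε : ℝ, 0 < ε → inner ℝ v d - ε * ‖d‖ ≤ fderiv ℝ f x d + (s - r) := by
    intro ε hε
    have hray : Tendsto (fun t : ℝ => x + t • d) (𝓝[>] 0) (𝓝 x) := by
      have : Continuous fun t : ℝ => x + t • d := by fun_prop
      simpa using (this.tendsto 0).mono_left nhdsWithin_le_nhds
    refine ge_of_tendsto ((tendsto_ray hf x d).add_const (s - r)) ?_
    filter_upwards [hray.eventually (hv.2.2 ε hε), self_mem_nhdsWithin,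
      nhdsWithin_le_nhds (Iio_mem_nhds (zero_lt_one' ℝ))] with t h1 h2 h3
    have ht : 0 < t := h2
    have h4 := hg.le_segment hx hz ht.le (le_of_lt h3)
    rw [← hd] at h4
    have h5 : phi f g (x + t • d) ≤ ((f (x + t • d) + (r + t * (s - r)) : ℝ) : EReal) := by
      rw [phi, EReal.coe_add]
      gcongr
    rw [phi_eq_coe hx] at h1
    have h6 := h1.trans h5
    rw [← EReal.coe_add, EReal.coe_le_coe_iff, add_sub_cancel_left, inner_smul_right, norm_smul,
      Real.norm_of_nonneg ht.le] at h6
    rw [div_add' _ _ _ ht.ne', le_div_iff₀ ht]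
    linarith
  have hlim : Tendsto (fun ε : ℝ => inner ℝ v d - ε * ‖d‖) (𝓝[>] 0) (𝓝 (inner ℝ v d)) := by
    have : Continuous fun ε : ℝ => inner ℝ v d - ε * ‖d‖ := by fun_prop
    simpa using (this.tendsto 0).mono_left nhdsWithin_le_nhds
  exact le_of_tendsto hlim (by filter_upwards [self_mem_nhdsWithin] with ε hε using key ε hε)

theorem IsStationary.firstOrder {n : ℕ} {f : Rn n → ℝ} (hf : ContDiff ℝ 2 f)
    {g : Rn n → EReal} (hbot : ∀ x, g x ≠ ⊥) (hg : IsPolyhedralFun g) {x : Rn n}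
    (h : IsStationary (phi f g) x) : FirstOrder f g x := by
  obtain ⟨htop, -, xs, vs, hxs, hphi, hvs, hmem⟩ := h
  obtain ⟨r, hr⟩ := exists_coe_of_phi hbot htop
  refine ⟨r, hr, fun z s hz => ?_⟩
  choose rs hrs using fun k => exists_coe_of_phi hbot (hmem k).1
  have hfx : Tendsto (fun k => f (xs k)) atTop (𝓝 (f x)) := (hf.continuous.tendsto x).comp hxs
  -- Convergence of the values of φ, minus that of f, gives convergence of the values of g.
  have hrlim : Tendsto rs atTop (𝓝 r) := by
    simp only [phi_eq_coe hr, phi_eq_coe (hrs _)] at hphi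
    simpa using (EReal.tendsto_coe.1 hphi).sub hfx
  have hd : Tendsto (fun k => z - xs k) atTop (𝓝 (z - x)) := hxs.const_sub z
  have hf' : Tendsto (fun k => fderiv ℝ f (xs k)) atTop (𝓝 (fderiv ℝ f x)) :=
    ((hf.continuous_fderiv (by norm_num)).tendsto x).comp hxs
  have hR := (((isBoundedBilinearMap_apply (𝕜 := ℝ)).continuous.tendsto _).comp
    (hf'.prodMk_nhds hd)).add (hrlim.const_sub s)
  have hle := le_of_tendsto_of_tendsto' (hvs.inner hd) hR fun k =>
    inner_le_of_mem_regularSubdiff (hf.differentiable (by norm_num)) hg (hrs k) hz (hmem k)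
  rw [inner_zero_left] at hle
  linarith

theorem isStationary_of_zero_mem {n : ℕ} {h : Rn n → EReal} {x : Rn n}
    (h0 : (0 : Rn n) ∈ regularSubdiff h x) : IsStationary h x :=
  ⟨h0.1, h0.2.1, fun _ => x, fun _ => 0, tendsto_const_nhds, tendsto_const_nhds,
    tendsto_const_nhds, fun _ => h0⟩

theorem FirstOrder.phi_le {n : ℕ} {f : Rn n → ℝ} {g : Rn n → EReal} (hbot : ∀ x, g x ≠ ⊥)
    {x z : Rn n} (h : FirstOrder f g x) {e : ℝ}
    (he : |f z - f x - fderiv ℝ f x (z - x)| ≤ e) :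
    phi f g x + ((-e : ℝ) : EReal) ≤ phi f g z := by
  obtain ⟨r, hr, hle⟩ := h
  rcases exists_coe_or_eq_top hbot z with ⟨s, hs⟩ | hs
  · rw [phi_eq_coe hr, phi_eq_coe hs, ← EReal.coe_add, EReal.coe_le_coe_iff]
    have := hle z s hs
    have := (abs_le.1 he).1
    linarith
  · rw [show phi f g z = ⊤ by rw [phi, hs, EReal.coe_add_top]]
    exact le_top

theorem FirstOrder.isStationary {n : ℕ} {f : Rn n → ℝ} (hf : Differentiable ℝ f)
    {g : Rn n → EReal} (hbot : ∀ x, g x ≠ ⊥) {x : Rn n} (h : FirstOrder f g x) :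
    IsStationary (phi f g) x := by
  obtain ⟨r, hr, -⟩ := id h
  refine isStationary_of_zero_mem ⟨?_, ?_, fun ε hε => ?_⟩
  · rw [phi_eq_coe hr]; exact EReal.coe_ne_top _
  · rw [phi_eq_coe hr]; exact EReal.coe_ne_bot _
  · filter_upwards [(hf x).hasFDerivAt.isLittleO.def hε] with z hz
    rw [inner_zero_left, zero_sub]
    exact h.phi_le hbot hz

/-! ### From the first-order condition to Φ -/

/-- Quadratic bound for the first-order Taylor remainder of a `C²` function. -/
theorem exists_taylor_bound {n : ℕ} {f : Rn n → ℝ} (hf : ContDiff ℝ 2 f) (x : Rn n) :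
    ∃ C : ℝ, 0 ≤ C ∧ ∀ᶠ z in 𝓝 x, |f z - f x - fderiv ℝ f x (z - x)| ≤ C * ‖z - x‖ ^ 2 := by
  have h1 : ContDiff ℝ 1 (fderiv ℝ f) := hf.fderiv_right (by norm_num)
  obtain ⟨K, t, ht, hK⟩ := h1.contDiffAt.exists_lipschitzOnWith (x := x)
  obtain ⟨ρ, hρ, hball⟩ := Metric.mem_nhds_iff.1 ht
  refine ⟨K, K.2, ?_⟩
  filter_upwards [Metric.ball_mem_nhds x hρ] with z hz
  have hsub : Metric.closedBall x ‖z - x‖ ⊆ t := by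
    refine (Metric.closedBall_subset_ball ?_).trans hball
    rwa [← dist_eq_norm]
  have hb : ∀ u ∈ Metric.closedBall x ‖z - x‖,
      ‖fderiv ℝ f u - fderiv ℝ f x‖ ≤ K * ‖z - x‖ := by
    intro u hu
    rw [← dist_eq_norm]
    refine (hK.dist_le_mul u (hsub hu) x (mem_of_mem_nhds ht)).trans ?_
    exact mul_le_mul_of_nonneg_left hu K.2
  have := (convex_closedBall x ‖z - x‖).norm_image_sub_le_of_norm_fderiv_le'
    (fun u _ => hf.differentiable (by norm_num) u) hb
    (Metric.mem_closedBall_self (norm_nonneg _)) (Metric.mem_closedBall.2 (dist_eq_norm z x).le)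
  rw [Real.norm_eq_abs] at this
  rwa [pow_two, ← mul_assoc]

theorem continuous_sq {n : ℕ} : Continuous (sq : Rn n → Rn n) := by
  unfold sq
  fun_prop

theorem differentiable_sq {n : ℕ} : Differentiable ℝ (sq : Rn n → Rn n) :=
  differentiable_euclidean.2 fun i => by
    simp only [sq]
    fun_prop

theorem FirstOrder.exists_Phi_lower_bound {n : ℕ} {f : Rn n → ℝ} (hf : ContDiff ℝ 2 f)
    {g : Rn n → EReal} (hbot : ∀ x, g x ≠ ⊥) {y : Rn n} (h : FirstOrder f g (sq y)) :
    ∃ C : ℝ, 0 ≤ C ∧ ∀ᶠ u in 𝓝 y,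
      Phi f g y + ((-(C * ‖sq u - sq y‖ ^ 2) : ℝ) : EReal) ≤ Phi f g u := by
  obtain ⟨C, hC, hev⟩ := exists_taylor_bound hf (sq y)
  refine ⟨C, hC, ?_⟩
  filter_upwards [continuous_sq.continuousAt.eventually hev] with u hu
  exact h.phi_le hbot hu

theorem FirstOrder.isStationary_Phi {n : ℕ} {f : Rn n → ℝ} (hf : ContDiff ℝ 2 f)
    {g : Rn n → EReal} (hbot : ∀ x, g x ≠ ⊥) {y : Rn n} (h : FirstOrder f g (sq y)) :
    IsStationary (Phi f g) y := by
  obtain ⟨C, hC, hev⟩ := h.exists_Phi_lower_bound hf hbot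
  obtain ⟨r, hr, -⟩ := id h
  have hval : Phi f g y = ((f (sq y) + r : ℝ) : EReal) := phi_eq_coe hr
  refine isStationary_of_zero_mem ⟨?_, ?_, fun ε hε => ?_⟩
  · rw [hval]; exact EReal.coe_ne_top _
  · rw [hval]; exact EReal.coe_ne_bot _
  have hO : (fun u => sq u - sq y) =O[𝓝 y] fun u => u - y := (differentiable_sq y).isBigO_sub
  have ho : (fun u => C * ‖sq u - sq y‖ ^ 2) =o[𝓝 y] fun u => u - y := by
    have h1 : (fun u => ‖sq u - sq y‖ ^ 2) =O[𝓝 y] fun u => ‖u - y‖ ^ 2 := hO.norm_norm.pow 2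
    have h2 : (fun u : Rn n => ‖u - y‖ ^ 2) =o[𝓝 y] fun u => u - y :=
      Asymptotics.isLittleO_norm_pow_id one_lt_two |>.comp_tendsto
        (tendsto_sub_nhds_zero_iff.2 tendsto_id)
    exact (h1.trans_isLittleO h2).const_mul_left C
  filter_upwards [hev, ho.def hε] with u h1 h2
  refine le_trans ?_ h1
  rw [inner_zero_left, zero_sub]
  exact add_le_add le_rfl (EReal.coe_le_coe_iff.2 (neg_le_neg ((le_abs_self _).trans h2)))

theorem FirstOrder.secondSubderiv_nonneg {n : ℕ} {f : Rn n → ℝ} (hf : ContDiff ℝ 2 f)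
    {g : Rn n → EReal} (hbot : ∀ x, g x ≠ ⊥) {y : Rn n} (h : FirstOrder f g (sq y))
    {w : Rn n} (hw : w ∈ vanishingOn (supp y)) :
    0 ≤ secondSubderiv (Phi f g) y 0 w := by
  obtain ⟨C, hC, hev⟩ := h.exists_Phi_lower_bound hf hbot
  obtain ⟨r, hr, -⟩ := id h
  have hval : Phi f g y = ((f (sq y) + r : ℝ) : EReal) := phi_eq_coe hr
  let D : ℝ × Rn n → Rn n := fun q =>
    WithLp.toLp 2 (fun i => 2 * y i * q.2 i + q.1 * q.2 i ^ 2)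
  have hD : Continuous D := by
    unfold D
    fun_prop
  -- This is where w ∈ S_I is needed: y i * w i = 0 for every i.
  have hD0 : D (0, w) = 0 := by
    ext i
    by_cases hi : y i = 0
    · simp [D, hi]
    · simp [D, hw i hi]
  have hsq : ∀ q : ℝ × Rn n, sq (y + q.1 • q.2) - sq y = q.1 • D q := by
    intro q
    ext i
    simp [D, sq]
    ring
  have hl : 𝓝[>] (0 : ℝ) ×ˢ 𝓝 w ≤ 𝓝 ((0 : ℝ), w) := by
    rw [nhds_prod_eq]
    exact Filter.prod_mono nhdsWithin_le_nhds le_rfl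
  have hto : Tendsto (fun q : ℝ × Rn n => y + q.1 • q.2) (𝓝[>] (0 : ℝ) ×ˢ 𝓝 w) (𝓝 y) := by
    have : Continuous fun q : ℝ × Rn n => y + q.1 • q.2 := by fun_prop
    simpa using (this.tendsto (0, w)).mono_left hl
  have hlim : Tendsto (fun q => 2 * (C * ‖D q‖ ^ 2)) (𝓝[>] (0 : ℝ) ×ˢ 𝓝 w) (𝓝 0) := by
    have : Continuous fun q => 2 * (C * ‖D q‖ ^ 2) := by fun_prop
    simpa [hD0] using (this.tendsto (0, w)).mono_left hl
  refine le_of_forall_lt fun c hc => ?_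
  obtain ⟨e, hce, he⟩ := EReal.lt_iff_exists_real_btwn.1 hc
  have he' : e < 0 := by exact_mod_cast he
  refine hce.trans_le (le_liminf_of_le (by isBoundedDefault) ?_)
  filter_upwards [hto.eventually hev, hlim.eventually (gt_mem_nhds (neg_pos.2 he')),
    tendsto_fst.eventually self_mem_nhdsWithin] with q h1 h2 h3
  have ht : 0 < q.1 := h3
  have ht2 : (0 : ℝ) < q.1 ^ 2 / 2 := by positivity
  rw [EReal.le_div_iff_mul_le (by exact_mod_cast ht2) (EReal.coe_ne_top _)]
  rw [inner_zero_left, mul_zero, EReal.coe_zero, sub_zero]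
  rw [hsq, norm_smul, Real.norm_of_nonneg ht.le, hval, ← EReal.coe_add] at h1
  rw [hval, ← EReal.coe_mul]
  refine le_trans ?_ (EReal.sub_le_sub h1 le_rfl)
  rw [← EReal.coe_sub, EReal.coe_le_coe_iff]
  nlinarith [mul_le_mul_of_nonneg_right h2.le ht2.le]

/-! ### Lifting segments through the square map -/

/-- The velocity `w` with `(y + t w)² = y² + t² d`. -/
noncomputable def sqrtVelocity {n : ℕ} (y d : Rn n) (t : ℝ) : Rn n :=
  WithLp.toLp 2 fun i =>
    -- The second branch is y i * (√(1 + t² d i / y i²) - 1) / t, rationalized so that it is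
    -- continuous and vanishes at t = 0.
    if y i = 0 then √(d i) else t * d i / (y i * (√(1 + t ^ 2 * d i / y i ^ 2) + 1))

theorem sqrtVelocity_zero_mem {n : ℕ} (y d : Rn n) :
    sqrtVelocity y d 0 ∈ vanishingOn (supp y) := by
  intro i hi
  have hi' : y i ≠ 0 := hi
  simp [sqrtVelocity, hi']

theorem continuous_sqrtVelocity {n : ℕ} (y d : Rn n) : Continuous (sqrtVelocity y d) := by
  refine (PiLp.continuous_toLp 2 _).comp (continuous_pi fun i => ?_)
  by_cases hi : y i = 0
  · simp only [hi, if_true]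
    exact continuous_const
  · simp only [hi, if_false]
    refine Continuous.div (by fun_prop) (by fun_prop) fun t => ?_
    exact mul_ne_zero hi (by positivity)

theorem sq_add_smul_sqrtVelocity {n : ℕ} {y d : Rn n} {t : ℝ}
    (h0 : ∀ i, y i = 0 → 0 ≤ d i) (h1 : ∀ i, 0 ≤ y i ^ 2 + t ^ 2 * d i) :
    sq (y + t • sqrtVelocity y d t) = sq y + t ^ 2 • d := by
  ext i
  by_cases hi : y i = 0
  · simp [sq, sqrtVelocity, hi, mul_pow, Real.sq_sqrt (h0 i hi)]
  · have hy : 0 < y i ^ 2 := by positivity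
    have hnn : 0 ≤ 1 + t ^ 2 * d i / y i ^ 2 := by
      have := div_nonneg (h1 i) hy.le
      rwa [add_div, div_self hy.ne'] at this
    have hs := Real.sq_sqrt hnn
    have hs0 := Real.sqrt_nonneg (1 + t ^ 2 * d i / y i ^ 2)
    simp only [sq, sqrtVelocity, hi, if_false, PiLp.add_apply, PiLp.smul_apply, smul_eq_mul]
    generalize √(1 + t ^ 2 * d i / y i ^ 2) = s at hs hs0
    have htd : t ^ 2 * d i = y i ^ 2 * (s ^ 2 - 1) := by
      rw [hs]
      field_simp
      ring
    have hlin : y i + t * (t * d i / (y i * (s + 1))) = y i * s := by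
      have : t * (t * d i / (y i * (s + 1))) = (t ^ 2 * d i) / (y i * (s + 1)) := by ring
      rw [this, htd]
      field_simp
      ring
    rw [hlin, htd]
    ring

theorem FirstOrder.of_secondSubderiv_nonneg {n : ℕ} {f : Rn n → ℝ} (hf : Differentiable ℝ f)
    {g : Rn n → EReal} (hbot : ∀ x, g x ≠ ⊥) (hg : IsPolyhedralFun g)
    (hdom : dom g ⊆ nonnegOrthant n) {y : Rn n} (hfin : Phi f g y ≠ ⊤)
    (h : ∀ w ∈ vanishingOn (supp y), 0 ≤ secondSubderiv (Phi f g) y 0 w) :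
    FirstOrder f g (sq y) := by
  obtain ⟨r, hr⟩ := exists_coe_of_phi hbot (show phi f g (sq y) ≠ ⊤ from hfin)
  have hval : Phi f g y = ((f (sq y) + r : ℝ) : EReal) := phi_eq_coe hr
  refine ⟨r, hr, fun z s hz => ?_⟩
  have hz0 : ∀ i, 0 ≤ z i := hdom (show g z < ⊤ by rw [hz]; exact EReal.coe_lt_top s)
  set d := z - sq y with hd
  have hdi : ∀ i, d i = z i - y i ^ 2 := fun i => by simp [hd, sq]
  have hcurve : Tendsto (fun t : ℝ => (t, sqrtVelocity y d t)) (𝓝[>] 0)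
      (𝓝[>] (0 : ℝ) ×ˢ 𝓝 (sqrtVelocity y d 0)) :=
    tendsto_id.prodMk
      (((continuous_sqrtVelocity y d).tendsto 0).mono_left nhdsWithin_le_nhds)
  have hsqto : Tendsto (fun t : ℝ => t ^ 2) (𝓝[>] 0) (𝓝[>] 0) := by
    refine tendsto_nhdsWithin_iff.2 ⟨?_, ?_⟩
    · have : Continuous fun t : ℝ => t ^ 2 := by fun_prop
      simpa using (this.tendsto 0).mono_left nhdsWithin_le_nhds
    · filter_upwards [self_mem_nhdsWithin] with t ht
      exact pow_pos (show (0 : ℝ) < t from ht) 2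
  have hlim := ((tendsto_ray hf (sq y) d).comp hsqto).add_const (s - r)
  -- The factor 1/2 is the one in the denominator t²/2 of the second subderivative.
  have key : ∀ e : ℝ, e < 0 → e / 2 ≤ fderiv ℝ f (sq y) d + (s - r) := by
    intro e he
    have hlt : (e : EReal) < secondSubderiv (Phi f g) y 0 (sqrtVelocity y d 0) :=
      lt_of_lt_of_le (by exact_mod_cast he) (h _ (sqrtVelocity_zero_mem y d))
    refine ge_of_tendsto hlim ?_
    filter_upwards [hcurve.eventually (eventually_lt_of_lt_liminf hlt), self_mem_nhdsWithin,
      nhdsWithin_le_nhds (Iio_mem_nhds (zero_lt_one' ℝ))] with t h1 h2 h3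
    have ht : 0 < t := h2
    have ht1 : t ^ 2 ≤ 1 := pow_le_one₀ ht.le (le_of_lt h3)
    have ht2 : (0 : ℝ) < t ^ 2 / 2 := by positivity
    have hsq : sq (y + t • sqrtVelocity y d t) = sq y + t ^ 2 • d := by
      refine sq_add_smul_sqrtVelocity (fun i hi => ?_) (fun i => ?_)
      · rw [hdi, hi]
        simpa using hz0 i
      · rw [hdi]
        -- The sum is the convex combination (1 - t²) y i² + t² z i of nonnegative numbers.
        nlinarith [mul_nonneg (sq_nonneg t) (hz0 i),
          mul_nonneg (sub_nonneg.2 ht1) (sq_nonneg (y i))]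
    have h4 := hg.le_segment hr hz (sq_nonneg t) ht1
    rw [← hd] at h4
    have h5 : Phi f g (y + t • sqrtVelocity y d t) ≤
        ((f (sq y + t ^ 2 • d) + (r + t ^ 2 * (s - r)) : ℝ) : EReal) := by
      rw [Phi, hsq, EReal.coe_add]
      gcongr
    have h6 := (EReal.le_div_iff_mul_le (by exact_mod_cast ht2) (EReal.coe_ne_top _)).1 h1.le
    rw [inner_zero_left, mul_zero, EReal.coe_zero, sub_zero, hval, ← EReal.coe_mul] at h6
    have h7 := h6.trans (EReal.sub_le_sub h5 le_rfl)
    rw [← EReal.coe_sub, EReal.coe_le_coe_iff] at h7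
    simp only [Function.comp_apply]
    rw [div_add' _ _ _ (pow_pos ht 2).ne', le_div_iff₀ (pow_pos ht 2)]
    linarith
  have hge : 0 ≤ fderiv ℝ f (sq y) d + (s - r) := by
    by_contra! hneg
    -- A negative e cannot satisfy e / 2 ≤ e.
    have := key _ hneg
    linarith
  linarith

end SquareReparam

theorem proposition4p3 (n : ℕ) (f : SquareReparam.Rn n → ℝ) (hf : ContDiff ℝ 2 f)
    (g : SquareReparam.Rn n → EReal) (hg_proper : SquareReparam.IsProper g)
    (hg_poly : SquareReparam.IsPolyhedralFun g)
    (hg_dom : SquareReparam.dom g ⊆ SquareReparam.nonnegOrthant n)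
    (y : SquareReparam.Rn n) :
    (SquareReparam.IsStationary (SquareReparam.Phi f g) y ∧
      ∀ w ∈ SquareReparam.vanishingOn (SquareReparam.supp y),
        0 ≤ SquareReparam.secondSubderiv (SquareReparam.Phi f g) y 0 w) ↔
    SquareReparam.IsStationary (SquareReparam.phi f g) (SquareReparam.sq y) := by
  have hdiff : Differentiable ℝ f := hf.differentiable (by norm_num)
  constructor
  · rintro ⟨hstat, hsecond⟩
    exact (SquareReparam.FirstOrder.of_secondSubderiv_nonneg hdiff hg_proper.2 hg_poly hg_dom
      hstat.1 hsecond).isStationary hdiff hg_proper.2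
  · intro h
    have hfo := h.firstOrder hf hg_proper.2 hg_poly
    exact ⟨hfo.isStationary_Phi hf hg_proper.2,
      fun w hw => hfo.secondSubderiv_nonneg hf hg_proper.2 hw⟩
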